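/- Let $D\ge 1$, let $\mathcal H$ be a real Hilbert space and let $\mathcal A=\{a(\theta):\theta\in\mathbb R^D\}\subset\mathcal H$ be a Generalized Laplace dictionary, i.e. there are $\lambda>0$ and $0<p\le 1$ such that its induced kernel is $$\kappa(\theta,\theta'):=\langle a(\theta),a(\theta')\rangle=e^{-\lambda\|\theta-\theta'\|_p^p}\qquad\text{for all }\theta,\theta'\in\mathbb R^D,$$ where $\|x\|_p^p=\sum_{i=1}^D|x[i]|^p$. Then every Cartesian grid, i.e. every set $\mathcal G=\prod_{d=1}^D\mathcal S_d=\{\theta_\ell\}_{\ell=1}^{n}$ with $\mathcal S_1,\dots,\mathcal S_D\subset\mathbb R$ finite and $n=\operatorname{card}(\mathcal G)$, is axis admissible with respect to $\mathcal A$. That is: for every $d\in\{1,\dots,D\}$, every $\theta\in\mathbb R^D$ with $\theta[d]=0$ and all real coefficients $c_1,\dots,c_n$ such that the function $$f_d(t)=\Big|\sum_{\ell=1}^{n}c_\ell\,\kappa(\theta+t\,e_d,\theta_\ell)\Big|,\qquad t\in\mathbb R,$$ is not identically zero ($e_d$ denotes the $d$-th canonical basis vector), one has $$\emptyset\neq\operatorname*{arg\,max}_{t\in\mathbb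 R}f_d(t)\subseteq\mathcal S_d .$$ -/

import Mathlib

/-- The kernel `κ(θ, θ') = ⟪a(θ), a(θ')⟫` induced by a dictionary `{a(θ) : θ ∈ ℝ^D}` of atoms of
a real Hilbert space. -/
def inducedKernel {D : ℕ} {H : Type*} [NormedAddCommGroup H] [InnerProductSpace ℝ H]
    (a : (Fin D → ℝ) → H) (θ θ' : Fin D → ℝ) : ℝ :=
  inner ℝ (a θ) (a θ')

/-- The class of Generalized Laplace kernels in dimension `D`: kernels
`κ(θ, θ') = exp (-λ ‖θ - θ'‖_p ^ p)` with `λ > 0` and `0 < p ≤ 1`. The norm is the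
`ℓ_p` (quasi-)norm `(∑ i, |x i| ^ p) ^ (1 / p)` on `ℝ^D`. -/
def IsGeneralizedLaplaceKernel {D : ℕ} (κ : (Fin D → ℝ) → (Fin D → ℝ) → ℝ) : Prop :=
  ∃ lam p : ℝ, 0 < lam ∧ 0 < p ∧ p ≤ 1 ∧
    ∀ θ θ' : Fin D → ℝ,
      κ θ θ' = Real.exp (-lam * ‖WithLp.toLp (ENNReal.ofReal p) (θ - θ')‖ ^ p)

/-- The `p`-th power of the `ℓ_p` (quasi-)norm, computed in coordinates. -/
theorem norm_toLp_ofReal_rpow {D : ℕ} {p : ℝ} (hp : 0 < p) (x : Fin D → ℝ) :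
    ‖WithLp.toLp (ENNReal.ofReal p) x‖ ^ p = ∑ i, |x i| ^ p := by
  have h : (ENNReal.ofReal p).toReal = p := ENNReal.toReal_ofReal hp.le
  have hs : 0 ≤ ∑ i, |x i| ^ p :=
    Finset.sum_nonneg fun i _ => Real.rpow_nonneg (abs_nonneg _) _
  rw [PiLp.norm_eq_sum (by rw [h]; exact hp), h]
  simp only [Real.norm_eq_abs]
  rw [← Real.rpow_mul hs, one_div, inv_mul_cancel₀ hp.ne', Real.rpow_one]

/-- A Generalized Laplace dictionary: its induced kernel is a Generalized Laplace kernel. -/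
def IsGeneralizedLaplaceDictionary {D : ℕ} {H : Type*} [NormedAddCommGroup H]
    [InnerProductSpace ℝ H] (a : (Fin D → ℝ) → H) : Prop :=
  IsGeneralizedLaplaceKernel (inducedKernel a)

/-- A finite set `G ⊆ ℝ^D` is a Cartesian grid if it is a product of finite subsets of `ℝ`. -/
def IsCartesianGrid {D : ℕ} (G : Finset (Fin D → ℝ)) : Prop :=
  ∃ S : Fin D → Finset ℝ, G = Fintype.piFinset S

/-- The set of global maximizers of a function `f : ℝ → ℝ`. -/
def argmaxSet (f : ℝ → ℝ) : Set ℝ := {t | ∀ s, f s ≤ f t}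

/-- The function `t ↦ |∑ c_ℓ κ(θ + t e_d, θ_ℓ)|`, where `θ_ℓ` runs through the finite set `G` and
`c η` is the coefficient attached to the point `η` of `G`. -/
def axisSection {D : ℕ} (κ : (Fin D → ℝ) → (Fin D → ℝ) → ℝ) (G : Finset (Fin D → ℝ))
    (c : (Fin D → ℝ) → ℝ) (d : Fin D) (θ : Fin D → ℝ) (t : ℝ) : ℝ :=
  |∑ η ∈ G, c η * κ (θ + t • Pi.single d 1) η|

/-- Axis admissibility of a Cartesian grid `G = ∏ S_d` with respect to a kernel. (If `G` is
nonempty, its factors `S` are unique; if `G` is empty, all axis sections vanish. So it does not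
matter that all factorizations are considered.) -/
def IsAxisAdmissible {D : ℕ} (κ : (Fin D → ℝ) → (Fin D → ℝ) → ℝ)
    (G : Finset (Fin D → ℝ)) : Prop :=
  IsCartesianGrid G ∧
    ∀ S : Fin D → Finset ℝ, G = Fintype.piFinset S →
      ∀ (d : Fin D) (θ : Fin D → ℝ), θ d = 0 → ∀ c : (Fin D → ℝ) → ℝ,
        (∃ t, axisSection κ G c d θ t ≠ 0) →
          (argmaxSet (axisSection κ G c d θ)).Nonempty ∧
            argmaxSet (axisSection κ G c d θ) ⊆ (S d : Set ℝ)

/-- Axis admissibility with respect to a dictionary, i.e. to its induced kernel. -/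
def IsAxisAdmissibleForDictionary {D : ℕ} {H : Type*} [NormedAddCommGroup H]
    [InnerProductSpace ℝ H] (a : (Fin D → ℝ) → H) (G : Finset (Fin D → ℝ)) : Prop :=
  IsAxisAdmissible (inducedKernel a) G

/-! On one axis the kernel factorizes, so a section is `|u t|` with `u t = ∑ s ∈ S, c s * φ (t - s)`
and `φ x = exp (-λ|x|^p)`. What is needed is potential theory on the line: a maximum principle for
such `u`, then strictness off `S`.

`posMaxPrinciple_sum_exp` gives the principle for positive mixtures of `exp (-μ|x|)`: the components
of the potential solve `z_j'' = μ_j² z_j` off `S`, and a basis adapted to the kinks at `S`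
(`exists_arrow_form`) turns this into a system with a scalar maximum principle. The principle
survives pointwise limits, and `exp (-λ|x|^p)` is such a limit: `x^p` is an integral of functions `1
- exp (-m x)`, so `φ` is a limit of positive constants times exponentials of mixtures
(`exp_neg_mul_abs_rpow_mem_topologicalClosure`).

Strictness is lost in the limit. It is recovered in `PosMaxPrinciple.sum_lt_of_notMem` by comparing
`u` with the equilibrium potential, which is `1` on `S` and, `φ` being strictly midpoint convex off
`0`, less than `1` elsewhere. -/

open Filter Topology

/-! ### Linear algebra: arrow form and Schur complement. -/

/-- If `A` is a positive definite symmetric operator and `p ≠ 0`, then diagonalizing the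
compression of `A` to the orthogonal complement of `p` brings `A` to arrow form. -/
theorem exists_arrow_form {E : Type*} [NormedAddCommGroup E] [InnerProductSpace ℝ E]
    [FiniteDimensional ℝ E] (A : E →ₗ[ℝ] E) (hA : A.IsSymmetric)
    (hpos : ∀ x, x ≠ 0 → 0 < inner ℝ (A x) x) (p : E) (hp : p ≠ 0) :
    ∃ (n : ℕ) (f : Fin n → E) (d b : Fin n → ℝ) (a r : ℝ), 0 < r ∧ (∀ i, 0 < d i) ∧
      (∀ i, inner ℝ (f i) p = 0) ∧ (∀ i, A (f i) = d i • f i + b i • p) ∧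
      A p = a • p + ∑ i, (r * b i) • f i ∧ 0 < a - ∑ i, r * (b i ^ 2 / d i) := by
  classical
  let K : Submodule ℝ E := (ℝ ∙ p)ᗮ
  let T : K →ₗ[ℝ] K := (K.orthogonalProjectionOnto : E →ₗ[ℝ] K) ∘ₗ A ∘ₗ K.subtype
  have hTin : ∀ x y : K, inner ℝ (T x) y = inner ℝ (A (x : E)) (y : E) := fun x y => by
    simp [T]
  have hT : T.IsSymmetric := fun x y => by
    rw [hTin, hA, real_inner_comm, ← hTin, real_inner_comm]
  have hn : Module.finrank ℝ K = Module.finrank ℝ K := rfl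
  let e := hT.eigenvectorBasis hn
  let f : Fin (Module.finrank ℝ K) → E := fun i => (e i : E)
  let d := hT.eigenvalues hn
  have hr : 0 < inner ℝ p p := real_inner_self_pos.2 hp
  set r : ℝ := inner ℝ p p with hrdef
  let b : Fin (Module.finrank ℝ K) → ℝ := fun i => inner ℝ (A (f i)) p / r
  let a : ℝ := inner ℝ (A p) p / r
  have hfp : ∀ i, inner ℝ (f i) p = 0 := fun i => by
    have := (e i).2
    rw [real_inner_comm]
    exact (Submodule.mem_orthogonal_singleton_iff_inner_right).1 this
  have hff : ∀ i j, inner ℝ (f i) (f j) = if i = j then (1 : ℝ) else 0 := fun i j => by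
    have := (orthonormal_iff_ite.1 e.orthonormal) i j
    simpa [f] using this
  have hAff : ∀ i j, inner ℝ (A (f i)) (f j) = if i = j then d i else 0 := fun i j => by
    have h1 : inner ℝ (A (f i)) (f j) = inner ℝ (T (e i)) (e j) := (hTin _ _).symm
    have h2 : T (e i) = d i • e i := by simp [e, d]
    have h3 := (orthonormal_iff_ite.1 e.orthonormal) i j
    rw [h1, h2, real_inner_smul_left, h3]
    simp
  have hext : ∀ x : E, inner ℝ x p = 0 → (∀ i, inner ℝ x (f i) = 0) → x = 0 := fun x hx hxf => by
    have hxK : x ∈ K := by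
      rw [Submodule.mem_orthogonal_singleton_iff_inner_right, real_inner_comm]; exact hx
    have h0 : (⟨x, hxK⟩ : K) = 0 := by
      apply e.repr.injective
      ext i
      rw [e.repr_apply_apply, map_zero, real_inner_comm]
      exact hxf i
    exact congrArg Subtype.val h0
  have hfi : ∀ i, A (f i) = d i • f i + b i • p := fun i => by
    rw [← sub_eq_zero]
    apply hext
    · rw [inner_sub_left, inner_add_left, real_inner_smul_left, real_inner_smul_left, hfp]
      simp only [b]
      field_simp
      simp [hrdef]
    · intro j
      rw [inner_sub_left, inner_add_left, real_inner_smul_left, real_inner_smul_left, hAff, hff,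
        real_inner_comm, hfp]
      simp
  have hAp : A p = a • p + ∑ i, (r * b i) • f i := by
    rw [← sub_eq_zero]
    apply hext
    · rw [inner_sub_left, inner_add_left, real_inner_smul_left, sum_inner]
      simp only [real_inner_smul_left, hfp, a]
      field_simp
      simp [hrdef]
    · intro j
      rw [inner_sub_left, inner_add_left, real_inner_smul_left, sum_inner, hA, real_inner_comm _ p,
        real_inner_comm (f j) p, hfp j]
      simp only [real_inner_smul_left, hff, b]
      simp
      field_simp
      simp
  have hd : ∀ i, 0 < d i := fun i => by
    have h := hAff i i
    rw [if_pos rfl] at h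
    rw [← h]
    apply hpos
    intro h0
    have := hff i i
    simp [h0] at this
  refine ⟨_, f, d, b, a, r, hr, hd, hfp, hfi, hAp, ?_⟩
  -- Eliminating the `f i` leaves `A h` a multiple of `p`; the factor is the Schur complement, and
  -- testing positivity on `h` gives its sign.
  let h : E := p - ∑ i, (r * b i / d i) • f i
  have hhp : inner ℝ p h = r := by
    simp only [h]
    rw [inner_sub_right, inner_sum]
    simp only [real_inner_smul_right, fun i => real_inner_comm (f i) p ▸ hfp i]
    simp [hrdef]
  have hAh : A h = (a - ∑ i, r * (b i ^ 2 / d i)) • p := by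
    have h1 : ∀ i, (r * b i / d i) • A (f i) = (r * b i) • f i + (r * (b i ^ 2 / d i)) • p :=
      fun i => by
        rw [hfi, smul_add, smul_smul, smul_smul]
        have := (hd i).ne'
        congr 2 <;> field_simp
    simp only [h, map_sub, map_sum, map_smul, h1, Finset.sum_add_distrib, ← Finset.sum_smul, hAp]
    rw [sub_smul]
    abel
  have hh0 : h ≠ 0 := fun h0 => by
    rw [h0, inner_zero_right] at hhp
    exact hr.ne hhp
  have := hpos h hh0
  rw [hAh, real_inner_smul_left, hhp] at this
  exact pos_of_mul_pos_left this hr.le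

/-! ### The maximum principle for mixtures of Laplace kernels. -/

theorem tendsto_exp_mul_sub_one_sub_div_sq (a : ℝ) :
    Tendsto (fun h : ℝ => (Real.exp (a * h) - 1 - a * h) / h ^ 2) (𝓝[>] 0) (𝓝 (a ^ 2 / 2)) := by
  rw [← tendsto_sub_nhds_zero_iff]
  have hb : Tendsto (fun h : ℝ => |a| ^ 3 * h) (𝓝[>] 0) (𝓝 0) := by
    have : Tendsto (fun h : ℝ => |a| ^ 3 * h) (𝓝 0) (𝓝 (|a| ^ 3 * 0)) :=
      (continuous_const.mul continuous_id).tendsto 0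
    rw [mul_zero] at this
    exact this.mono_left nhdsWithin_le_nhds
  have hs : Tendsto (fun h : ℝ => |a| * h) (𝓝[>] 0) (𝓝 0) := by
    have : Tendsto (fun h : ℝ => |a| * h) (𝓝 0) (𝓝 (|a| * 0)) :=
      (continuous_const.mul continuous_id).tendsto 0
    rw [mul_zero] at this
    exact this.mono_left nhdsWithin_le_nhds
  refine squeeze_zero_norm' ?_ hb
  filter_upwards [self_mem_nhdsWithin, hs.eventually_lt_const one_pos] with h hh h1
  have hh' : (0 : ℝ) < h := hh
  have habs : |a * h| = |a| * h := by rw [abs_mul, abs_of_pos hh']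
  have hexp := Real.exp_bound (x := a * h) (by rw [habs]; exact h1.le) (n := 3) (by norm_num)
  have heq : (Real.exp (a * h) - 1 - a * h) / h ^ 2 - a ^ 2 / 2 =
      (Real.exp (a * h) - ∑ m ∈ Finset.range 3, (a * h) ^ m / (m.factorial : ℝ)) / h ^ 2 := by
    simp [Finset.sum_range_succ, Nat.factorial]
    field_simp
    ring
  rw [heq, Real.norm_eq_abs, abs_div, abs_of_pos (pow_pos hh' 2), div_le_iff₀ (pow_pos hh' 2)]
  refine hexp.trans ?_
  rw [habs]
  simp only [Nat.factorial]
  have h3 : 0 ≤ |a| ^ 3 * h ^ 3 := by positivity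
  norm_num
  nlinarith [h3]

/-- Symmetric second differences of `x ↦ exp (-μ|x|)`, with a correction for the kink at `0`. -/
theorem tendsto_second_difference_exp_neg_abs (μ x : ℝ) :
    Tendsto (fun h : ℝ => (Real.exp (-μ * |x + h|) + Real.exp (-μ * |x - h|)
        - 2 * Real.exp (-μ * |x|) + (if x = 0 then 2 * μ * h else 0)) / h ^ 2)
      (𝓝[>] 0) (𝓝 (μ ^ 2 * Real.exp (-μ * |x|))) := by
  have hm := tendsto_exp_mul_sub_one_sub_div_sq (-μ)
  have hp := tendsto_exp_mul_sub_one_sub_div_sq μ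
  by_cases hx : x = 0
  · subst hx
    have := hm.const_mul 2
    refine Tendsto.congr' ?_ (this.trans (le_of_eq (by congr 1; simp; ring)))
    filter_upwards [self_mem_nhdsWithin] with h hh
    have hh' : (0 : ℝ) < h := hh
    simp only [zero_add, zero_sub, abs_neg, abs_zero, mul_zero, Real.exp_zero, if_true,
      abs_of_pos hh']
    ring
  · have := (hm.add hp).const_mul (Real.exp (-μ * |x|))
    refine Tendsto.congr' ?_ (this.trans (le_of_eq (by congr 1; ring)))
    have hlt : ∀ᶠ h : ℝ in 𝓝[>] 0, h < |x| :=
      nhdsWithin_le_nhds (eventually_lt_nhds (abs_pos.2 hx))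
    filter_upwards [self_mem_nhdsWithin, hlt] with h hh hlt
    have hh' : (0 : ℝ) < h := hh
    have key : Real.exp (-μ * |x + h|) + Real.exp (-μ * |x - h|) =
        Real.exp (-μ * |x|) * Real.exp (-μ * h) + Real.exp (-μ * |x|) * Real.exp (μ * h) := by
      rw [← Real.exp_add, ← Real.exp_add]
      rcases lt_or_gt_of_ne hx with h0 | h0
      · rw [abs_of_neg h0] at hlt
        rw [abs_of_neg h0, abs_of_neg (by linarith : x + h < 0),
          abs_of_neg (by linarith : x - h < 0), add_comm]
        congr 2 <;> ring
      · rw [abs_of_pos h0] at hlt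
        rw [abs_of_pos h0, abs_of_pos (by linarith : 0 < x + h),
          abs_of_pos (by linarith : 0 < x - h)]
        congr 2 <;> ring
    rw [if_neg hx, key]
    ring

/-- The positive maximum principle for the potentials `∑ s ∈ S, c s * φ (· - s)`: a positive value
of such a potential is dominated by its value at some point of `S`. -/
def PosMaxPrinciple (φ : ℝ → ℝ) : Prop :=
  ∀ (S : Finset ℝ) (c : ℝ → ℝ) (t : ℝ), ∑ s ∈ S, c s * φ (t - s) ≤ 0 ∨
    ∃ s' ∈ S, ∑ s ∈ S, c s * φ (t - s) ≤ ∑ s ∈ S, c s * φ (s' - s)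

/-- A continuous function that vanishes at infinity and has a positive value has a positive
maximum. -/
theorem exists_pos_forall_le_of_tendsto_cocompact {F : ℝ → ℝ} (hF : Continuous F)
    (h0 : Tendsto F (cocompact ℝ) (𝓝 0)) {t : ℝ} (ht : 0 < F t) :
    ∃ t₀, 0 < F t₀ ∧ ∀ y, F y ≤ F t₀ := by
  obtain ⟨t₀, h⟩ := hF.exists_forall_ge' t ((h0.eventually_lt_const ht).mono fun _ h => h.le)
  exact ⟨t₀, ht.trans_le (h t), h⟩

theorem tendsto_exp_neg_mul_abs_sub_cocompact {μ : ℝ} (hμ : 0 < μ) (s : ℝ) :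
    Tendsto (fun t => Real.exp (-μ * |t - s|)) (cocompact ℝ) (𝓝 0) := by
  have h1 : Tendsto (fun t : ℝ => |t - s|) (cocompact ℝ) atTop := by
    have := tendsto_norm_cocompact_atTop.comp
      (Homeomorph.addRight (-s)).isClosedEmbedding.tendsto_cocompact
    exact this
  exact Real.tendsto_exp_atBot.comp (h1.const_mul_atTop_of_neg (neg_lt_zero.2 hμ))

/-- At a maximum the second differences are nonpositive, hence so is their limit. -/
theorem sum_exp_neg_abs_nonpos_of_forall_le {J : Type*} [Fintype J] (μ : J → ℝ) (S : Finset ℝ)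
    (c : ℝ → ℝ) (q : J → ℝ) (t : ℝ) (hq : t ∉ S ∨ ∑ j, q j * μ j = 0)
    (hmax : ∀ y, ∑ s ∈ S, c s * ∑ j, q j * Real.exp (-μ j * |y - s|) ≤
      ∑ s ∈ S, c s * ∑ j, q j * Real.exp (-μ j * |t - s|)) :
    ∑ s ∈ S, c s * ∑ j, q j * (μ j ^ 2 * Real.exp (-μ j * |t - s|)) ≤ 0 := by
  have hlim : Tendsto (fun h : ℝ => ∑ s ∈ S, c s * ∑ j, q j *
      ((Real.exp (-μ j * |t - s + h|) + Real.exp (-μ j * |t - s - h|)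
        - 2 * Real.exp (-μ j * |t - s|) + (if t - s = 0 then 2 * μ j * h else 0)) / h ^ 2))
      (𝓝[>] 0) (𝓝 (∑ s ∈ S, c s * ∑ j, q j * (μ j ^ 2 * Real.exp (-μ j * |t - s|)))) :=
    tendsto_finsetSum _ fun s _ => Tendsto.const_mul _ <| tendsto_finsetSum _ fun j _ =>
      Tendsto.const_mul _ <| tendsto_second_difference_exp_neg_abs _ _
  refine le_of_tendsto hlim ?_
  filter_upwards [self_mem_nhdsWithin] with h hh
  have hh' : (0 : ℝ) < h := hh
  have heq : ∑ s ∈ S, c s * ∑ j, q j *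
      ((Real.exp (-μ j * |t - s + h|) + Real.exp (-μ j * |t - s - h|)
        - 2 * Real.exp (-μ j * |t - s|) + (if t - s = 0 then 2 * μ j * h else 0)) / h ^ 2) =
      ((∑ s ∈ S, c s * ∑ j, q j * Real.exp (-μ j * |t + h - s|)) +
        (∑ s ∈ S, c s * ∑ j, q j * Real.exp (-μ j * |t - h - s|)) -
        2 * ∑ s ∈ S, c s * ∑ j, q j * Real.exp (-μ j * |t - s|)) / h ^ 2 := by
    rw [Finset.mul_sum, ← Finset.sum_add_distrib, ← Finset.sum_sub_distrib, Finset.sum_div]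
    refine Finset.sum_congr rfl fun s hs => ?_
    -- The kink corrections do not contribute: either `t ∉ S`, or the derivative jumps of the
    -- components cancel.
    have hz : ∑ j, q j * ((if t - s = 0 then 2 * μ j * h else 0)) = 0 := by
      split_ifs with h0
      · have ht : t = s := sub_eq_zero.1 h0
        subst ht
        have hq' := hq.resolve_left (not_not.2 hs)
        calc ∑ j, q j * (2 * μ j * h) = 2 * h * ∑ j, q j * μ j := by
              rw [Finset.mul_sum]
              exact Finset.sum_congr rfl fun j _ => by ring
          _ = 0 := by rw [hq', mul_zero]
      · simp
    calc _ = c s * ((∑ j, q j * Real.exp (-μ j * |t + h - s|)) +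
          (∑ j, q j * Real.exp (-μ j * |t - h - s|)) -
          2 * (∑ j, q j * Real.exp (-μ j * |t - s|)) +
          ∑ j, q j * ((if t - s = 0 then 2 * μ j * h else 0))) / h ^ 2 := by
          rw [Finset.mul_sum _ _ (2 : ℝ), ← Finset.sum_add_distrib, ← Finset.sum_sub_distrib,
            ← Finset.sum_add_distrib, mul_div_assoc, Finset.sum_div]
          congr 1
          refine Finset.sum_congr rfl fun j _ => ?_
          rw [show t - s + h = t + h - s by ring, show t - s - h = t - h - s by ring]
          ring
      _ = _ := by rw [hz]; ring
  rw [heq]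
  refine div_nonpos_of_nonpos_of_nonneg ?_ (sq_nonneg h)
  linarith [hmax (t + h), hmax (t - h)]

/-- Write `u_w = ⟪w, z⟫`. Off `S`, `u_w'' = u_{A w}`, and for `w ⊥ p` the kinks cancel, so this also
holds on `S`. In arrow form, `u_{f i}'' = d i * u_{f i} + b i * u_p` everywhere, which bounds `-b i
* u_{f i}` by `b i ^ 2 / d i` times the maximum `M` of `u_p`. If `M > 0` were attained off `S`, the
equation for `u_p''` would give (Schur complement) `* M ≤ 0`. -/
theorem posMaxPrinciple_sum_exp {J : Type*} [Fintype J] (μ ν : J → ℝ) (hμ : ∀ j, 0 < μ j)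
    (hν : ∀ j, 0 ≤ ν j) : PosMaxPrinciple fun x => ∑ j, ν j * Real.exp (-μ j * |x|) := by
  classical
  intro S c t
  -- Normalized so that `p j * (p j / (2 * μ j)) = ν j`, while the kink of `⟪w, z⟫` at a point of
  -- `S` is proportional to `⟪w, p⟫`.
  let p : EuclideanSpace ℝ J := WithLp.toLp 2 fun j => √(2 * μ j * ν j)
  let A : EuclideanSpace ℝ J →ₗ[ℝ] EuclideanSpace ℝ J := Matrix.toEuclideanLin
    (Matrix.diagonal fun j => μ j ^ 2)
  have hAapp : ∀ x j, A x j = μ j ^ 2 * x j := fun x j => by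
    simp [A, Matrix.toLpLin_apply, Matrix.mulVec_diagonal]
  have hin : ∀ x y : EuclideanSpace ℝ J, inner ℝ x y = ∑ j, x j * y j := fun x y => by
    simp [PiLp.inner_apply, mul_comm]
  have hA : A.IsSymmetric := fun x y => by
    simp only [hin, hAapp]
    exact Finset.sum_congr rfl fun j _ => by ring
  have hpos : ∀ x, x ≠ 0 → 0 < inner ℝ (A x) x := fun x hx => by
    have : ∃ j, x j ≠ 0 := by
      by_contra! h
      exact hx (by ext j; simpa using h j)
    obtain ⟨j, hj⟩ := this
    rw [hin]
    refine Finset.sum_pos' (fun i _ => ?_) ⟨j, Finset.mem_univ j, ?_⟩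
    · rw [hAapp]; nlinarith [mul_self_nonneg (μ i * x i)]
    · rw [hAapp, mul_assoc]
      exact mul_pos (pow_pos (hμ j) 2) (mul_self_pos.2 hj)
  let z : ℝ → EuclideanSpace ℝ J := fun t => WithLp.toLp 2 fun j =>
    ∑ s ∈ S, c s * (p j / (2 * μ j) * Real.exp (-μ j * |t - s|))
  have hz : ∀ w t, inner ℝ w (z t) =
      ∑ s ∈ S, c s * ∑ j, (w j * (p j / (2 * μ j))) * Real.exp (-μ j * |t - s|) := fun w t => by
    rw [hin]
    simp only [z, Finset.mul_sum]
    rw [Finset.sum_comm]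
    exact Finset.sum_congr rfl fun s _ => Finset.sum_congr rfl fun j _ => by ring
  have hg : ∀ t, ∑ s ∈ S, c s * ∑ j, ν j * Real.exp (-μ j * |t - s|) = inner ℝ p (z t) :=
    fun t => by
      rw [hz]
      refine Finset.sum_congr rfl fun s _ => ?_
      congr 1
      refine Finset.sum_congr rfl fun j _ => ?_
      congr 1
      have h2 : p j * p j = 2 * μ j * ν j :=
        Real.mul_self_sqrt (mul_nonneg (mul_nonneg zero_le_two (hμ j).le) (hν j))
      rw [← mul_div_assoc, h2]
      have := (hμ j).ne'
      field_simp
  have hcont : ∀ w, Continuous fun t => inner ℝ w (z t) := fun w => by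
    simp only [hz]
    fun_prop
  have hvan : ∀ w, Tendsto (fun t => inner ℝ w (z t)) (cocompact ℝ) (𝓝 0) := fun w => by
    simp only [hz]
    have : Tendsto (fun t => ∑ s ∈ S, c s * ∑ j, (w j * (p j / (2 * μ j))) *
        Real.exp (-μ j * |t - s|)) (cocompact ℝ)
        (𝓝 (∑ s ∈ S, c s * ∑ j, (w j * (p j / (2 * μ j))) * 0)) :=
      tendsto_finsetSum _ fun s _ => Tendsto.const_mul _ <| tendsto_finsetSum _ fun j _ =>
        Tendsto.const_mul _ <| tendsto_exp_neg_mul_abs_sub_cocompact (hμ j) s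
    simpa using this
  have hgen : ∀ w t, (t ∉ S ∨ inner ℝ w p = 0) → (∀ y, inner ℝ w (z y) ≤ inner ℝ w (z t)) →
      inner ℝ (A w) (z t) ≤ 0 := fun w t hw hmax => by
    have := sum_exp_neg_abs_nonpos_of_forall_le μ S c (fun j => w j * (p j / (2 * μ j))) t
      (hw.imp_right fun h => by
        rw [hin] at h
        have h2 : ∑ j, w j * (p j / (2 * μ j)) * μ j = (∑ j, w j * p j) / 2 := by
          rw [Finset.sum_div]
          refine Finset.sum_congr rfl fun j _ => ?_
          have := (hμ j).ne'
          field_simp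
        rw [h2, h, zero_div])
      (fun y => by simpa only [hz] using hmax y)
    refine le_trans (le_of_eq ?_) this
    rw [hz]
    refine Finset.sum_congr rfl fun s _ => ?_
    congr 1
    exact Finset.sum_congr rfl fun j _ => by rw [hAapp]; ring
  simp only [hg]
  by_cases hp : p = 0
  · left; simp [hp]
  obtain ⟨n, f, d, b, a, r, hr, hd, hfp, hAf, hAp, hschur⟩ := exists_arrow_form A hA hpos p hp
  rcases le_or_gt (inner ℝ p (z t)) 0 with h0 | h0
  · exact Or.inl h0
  right
  obtain ⟨t₀, ht₀, hmax⟩ := exists_pos_forall_le_of_tendsto_cocompact (hcont p) (hvan p) h0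
  refine ⟨t₀, ?_, hmax t⟩
  by_contra hS
  set M := inner ℝ p (z t₀) with hM
  -- The factor `-b i` handles both signs of `b i`. The maximizer `t₁` may lie in `S`, which is
  -- harmless because `f i ⊥ p`.
  have hbound : ∀ i x, -(b i * inner ℝ (f i) (z x)) ≤ b i ^ 2 / d i * M := fun i x => by
    have hw : ∀ y, inner ℝ ((-b i) • f i) (z y) = -(b i * inner ℝ (f i) (z y)) := fun y => by
      rw [real_inner_smul_left]; ring
    rw [← hw]
    have hnn : 0 ≤ b i ^ 2 / d i * M := mul_nonneg (div_nonneg (sq_nonneg _) (hd i).le) ht₀.le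
    rcases le_or_gt (inner ℝ ((-b i) • f i) (z x)) 0 with h1 | h1
    · exact h1.trans hnn
    obtain ⟨t₁, ht₁, hmax₁⟩ := exists_pos_forall_le_of_tendsto_cocompact (hcont _) (hvan _) h1
    refine (hmax₁ x).trans ?_
    have h2 := hgen ((-b i) • f i) t₁ (Or.inr (by rw [real_inner_smul_left, hfp, mul_zero])) hmax₁
    rw [map_smul, real_inner_smul_left, hAf, inner_add_left, real_inner_smul_left,
      real_inner_smul_left] at h2
    rw [hw, div_mul_eq_mul_div, le_div_iff₀ (hd i)]
    nlinarith [mul_le_mul_of_nonneg_left (hmax t₁) (sq_nonneg (b i))]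
  have h3 := hgen p t₀ (Or.inl hS) hmax
  rw [hAp, inner_add_left, real_inner_smul_left, sum_inner] at h3
  simp only [real_inner_smul_left] at h3
  have h4 : -(∑ i, r * (b i ^ 2 / d i)) * M ≤ ∑ i, r * b i * inner ℝ (f i) (z t₀) := by
    rw [neg_mul, Finset.sum_mul, ← Finset.sum_neg_distrib]
    refine Finset.sum_le_sum fun i _ => ?_
    nlinarith [mul_le_mul_of_nonneg_left (hbound i t₀) hr.le]
  nlinarith [mul_pos hschur ht₀]

/-! ### Pointwise limits of mixtures. -/

/-- The algebra (over the nonnegative reals) of nonnegative combinations of the functions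
`x ↦ exp (-μ|x|)`, `μ ≥ 0`. -/
noncomputable def expConeAlgebra : Subalgebra NNReal (ℝ → ℝ) :=
  Algebra.adjoin NNReal {f | ∃ μ : ℝ, 0 ≤ μ ∧ f = fun x => Real.exp (-μ * |x|)}

theorem exp_neg_mul_abs_mem_expConeAlgebra {μ : ℝ} (hμ : 0 ≤ μ) :
    (fun x => Real.exp (-μ * |x|)) ∈ expConeAlgebra :=
  Algebra.subset_adjoin ⟨μ, hμ, rfl⟩

theorem exists_eq_sum_exp_of_mem_expConeAlgebra {f : ℝ → ℝ} (hf : f ∈ expConeAlgebra) :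
    ∃ (J : Type) (_ : Fintype J) (μ ν : J → ℝ), (∀ j, 0 ≤ μ j) ∧ (∀ j, 0 ≤ ν j) ∧
      f = fun x => ∑ j, ν j * Real.exp (-μ j * |x|) := by
  have hclosure : ∀ g ∈ Submonoid.closure
      {f : ℝ → ℝ | ∃ μ : ℝ, 0 ≤ μ ∧ f = fun x => Real.exp (-μ * |x|)},
      ∃ μ : ℝ, 0 ≤ μ ∧ g = fun x => Real.exp (-μ * |x|) := fun g hg => by
    induction hg using Submonoid.closure_induction with
    | mem g hg => exact hg
    | one => exact ⟨0, le_rfl, by ext; simp⟩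
    | mul g g' _ _ hg hg' =>
      obtain ⟨a, ha, rfl⟩ := hg
      obtain ⟨b, hb, rfl⟩ := hg'
      refine ⟨a + b, add_nonneg ha hb, ?_⟩
      ext x
      rw [Pi.mul_apply, ← Real.exp_add]
      congr 1
      ring
  have hf' : f ∈ Submodule.span NNReal (Submonoid.closure
      {f : ℝ → ℝ | ∃ μ : ℝ, 0 ≤ μ ∧ f = fun x => Real.exp (-μ * |x|)} : Set (ℝ → ℝ)) := by
    rw [← Algebra.adjoin_eq_span]
    exact hf
  induction hf' using Submodule.span_induction with
  | mem g hg =>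
    obtain ⟨μ, hμ, rfl⟩ := hclosure g hg
    exact ⟨Unit, inferInstance, fun _ => μ, fun _ => 1, fun _ => hμ, fun _ => zero_le_one,
      by simp⟩
  | zero => exact ⟨Empty, inferInstance, fun _ => 0, fun _ => 0, by simp, by simp, by ext; simp⟩
  | add g g' hg1 hg1' hg hg' =>
    have hm : ∀ h ∈ Submodule.span NNReal (Submonoid.closure
        {f : ℝ → ℝ | ∃ μ : ℝ, 0 ≤ μ ∧ f = fun x => Real.exp (-μ * |x|)} : Set (ℝ → ℝ)),
        h ∈ expConeAlgebra := fun h hh => by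
      rw [← Algebra.adjoin_eq_span] at hh
      exact hh
    obtain ⟨J, _, μ, ν, hμ, hν, rfl⟩ := hg (hm _ hg1)
    obtain ⟨J', _, μ', ν', hμ', hν', rfl⟩ := hg' (hm _ hg1')
    refine ⟨J ⊕ J', inferInstance, Sum.elim μ μ', Sum.elim ν ν', ?_, ?_, ?_⟩
    · rintro (j | j)
      exacts [hμ j, hμ' j]
    · rintro (j | j)
      exacts [hν j, hν' j]
    · ext x
      simp
  | smul a g hg1 hg =>
    obtain ⟨J, _, μ, ν, hμ, hν, rfl⟩ := hg (by rw [← Algebra.adjoin_eq_span] at hg1; exact hg1)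
    refine ⟨J, inferInstance, μ, fun j => a * ν j, hμ, fun j => mul_nonneg a.2 (hν j), ?_⟩
    ext x
    simp [NNReal.smul_def, Finset.mul_sum, mul_assoc]

/-- For fixed `S`, `c`, `t` only finitely many values of `φ` enter, and the existential over `S` is
a finite union of closed conditions. -/
theorem isClosed_setOf_posMaxPrinciple : IsClosed {φ : ℝ → ℝ | PosMaxPrinciple φ} := by
  simp only [PosMaxPrinciple, Set.ofPred_forall]
  refine isClosed_iInter fun S => isClosed_iInter fun c => isClosed_iInter fun t => ?_
  have hcont : ∀ t, Continuous fun φ : ℝ → ℝ => ∑ s ∈ S, c s * φ (t - s) := fun t => by fun_prop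
  rw [Set.ofPred_or]
  refine (isClosed_le (hcont t) continuous_const).union ?_
  have : {φ : ℝ → ℝ | ∃ s' ∈ S, ∑ s ∈ S, c s * φ (t - s) ≤ ∑ s ∈ S, c s * φ (s' - s)} =
      ⋃ s' ∈ S, {φ : ℝ → ℝ | ∑ s ∈ S, c s * φ (t - s) ≤ ∑ s ∈ S, c s * φ (s' - s)} := by
    ext; simp
  rw [this]
  exact S.finite_toSet.isClosed_biUnion fun s' _ => isClosed_le (hcont t) (hcont s')

theorem posMaxPrinciple_of_mem_topologicalClosure {φ : ℝ → ℝ}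
    (hφ : φ ∈ expConeAlgebra.topologicalClosure) : PosMaxPrinciple φ := by
  refine closure_minimal (fun f hf => ?_) isClosed_setOf_posMaxPrinciple hφ
  obtain ⟨J, _, μ, ν, hμ, hν, rfl⟩ := exists_eq_sum_exp_of_mem_expConeAlgebra hf
  -- The rate `0` (constants) is allowed in the algebra, but the maximum principle was proved for
  -- positive rates; hence the shift by `ε`.
  have hlim : Tendsto (fun (ε : ℝ) (x : ℝ) => ∑ j, ν j * Real.exp (-(μ j + ε) * |x|)) (𝓝[>] 0)
      (𝓝 fun x => ∑ j, ν j * Real.exp (-μ j * |x|)) := by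
    rw [tendsto_pi_nhds]
    intro x
    have hc : Continuous fun ε : ℝ => ∑ j, ν j * Real.exp (-(μ j + ε) * |x|) := by fun_prop
    have := (hc.tendsto 0).mono_left (nhdsWithin_le_nhds (s := Set.Ioi 0))
    simpa using this
  refine isClosed_setOf_posMaxPrinciple.mem_of_tendsto hlim ?_
  filter_upwards [self_mem_nhdsWithin] with ε hε
  exact posMaxPrinciple_sum_exp _ ν (fun j => add_pos_of_nonneg_of_pos (hμ j) hε) hν

theorem exp_mem_topologicalClosure {f : ℝ → ℝ} (hf : f ∈ expConeAlgebra.topologicalClosure) :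
    (fun x => Real.exp (f x)) ∈ expConeAlgebra.topologicalClosure := by
  have hlim : Tendsto (fun (n : ℕ) (x : ℝ) => (1 + f x / n) ^ n) atTop
      (𝓝 fun x => Real.exp (f x)) :=
    tendsto_pi_nhds.2 fun x => Real.tendsto_one_add_div_pow_exp (f x)
  refine (Subalgebra.isClosed_topologicalClosure _).mem_of_tendsto hlim
    (Eventually.of_forall fun n => ?_)
  have h1 : (1 + (n : NNReal)⁻¹ • f) ^ n ∈ expConeAlgebra.topologicalClosure :=
    pow_mem (add_mem (one_mem _) (Subalgebra.smul_mem _ hf _)) n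
  refine SetLike.mem_coe.2 ?_
  convert h1 using 1
  ext x
  simp [NNReal.smul_def, div_eq_inv_mul]

/-- Reduces pointwise approximation to finite-dimensional spaces, where vector-valued integrals and
averages are available. -/
theorem mem_closure_of_forall_finset {α : Type*} {T : Set (α → ℝ)} {f : α → ℝ}
    (h : ∀ F : Finset α, (fun i : F => f i) ∈ closure ((fun (g : α → ℝ) (i : F) => g i) '' T)) :
    f ∈ closure T := by
  rw [mem_closure_iff]
  intro U hU hfU
  obtain ⟨I, u, hu, hsub⟩ := isOpen_pi_iff.1 hU f hfU
  have hopen : IsOpen (Set.pi Set.univ fun i : I => u i) :=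
    isOpen_set_pi Set.finite_univ fun i _ => (hu i i.2).1
  obtain ⟨_, hy, g, hg, rfl⟩ := mem_closure_iff.1 (h I) _ hopen fun i _ => (hu i i.2).2
  exact ⟨g, hsub fun i hi => hy ⟨i, hi⟩ trivial, hg⟩

open MeasureTheory in
-- Restricted to finitely many points, the integral is `b - a` times an average of elements of a
-- closed convex cone.
theorem integral_exp_mem_topologicalClosure {a b : ℝ} (ha : 0 ≤ a) (hab : a < b) {w : ℝ → ℝ}
    (hw : ∀ m ∈ Set.Ioc a b, 0 ≤ w m)
    (hint : ∀ x, IntegrableOn (fun m => w m * Real.exp (-m * |x|)) (Set.Ioc a b)) :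
    (fun x => ∫ m in Set.Ioc a b, w m * Real.exp (-m * |x|)) ∈
      expConeAlgebra.topologicalClosure := by
  refine mem_closure_of_forall_finset fun F => ?_
  set R : (ℝ → ℝ) → (F → ℝ) := fun g i => g i with hR
  set C : Set (F → ℝ) := closure (R '' expConeAlgebra) with hC
  have hsmul : ∀ k : ℝ, 0 ≤ k → ∀ y ∈ R '' expConeAlgebra, k • y ∈ R '' expConeAlgebra := by
    rintro k hk _ ⟨y, hy, rfl⟩
    exact ⟨(⟨k, hk⟩ : NNReal) • y, Subalgebra.smul_mem _ hy _, rfl⟩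
  have hconv : Convex ℝ (R '' expConeAlgebra) := by
    intro y hy y' hy' k k' hk hk' _
    obtain ⟨g, hg, hgy⟩ := hsmul k hk y hy
    obtain ⟨g', hg', hgy'⟩ := hsmul k' hk' y' hy'
    exact ⟨g + g', add_mem hg hg', by rw [← hgy, ← hgy']; rfl⟩
  let f : ℝ → F → ℝ := fun m i => w m * Real.exp (-m * |(i : ℝ)|)
  have hfi : IntegrableOn f (Set.Ioc a b) := Integrable.of_eval fun i => hint i
  have hmem : ∀ᵐ m ∂volume.restrict (Set.Ioc a b), f m ∈ C := by
    filter_upwards [ae_restrict_mem measurableSet_Ioc] with m hm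
    refine subset_closure ?_
    exact hsmul (w m) (hw m hm) _
      ⟨_, exp_neg_mul_abs_mem_expConeAlgebra (ha.trans hm.1.le), rfl⟩
  have hvol : volume.real (Set.Ioc a b) = b - a := by simp [hab.le]
  have havg := hconv.closure.set_average_mem isClosed_closure
    (by simp [hab] : volume (Set.Ioc a b) ≠ 0) (by simp) hmem hfi
  rw [setAverage_eq, hvol] at havg
  have h2 : (b - a) • ((b - a)⁻¹ • ∫ m in Set.Ioc a b, f m) ∈ C := by
    refine map_mem_closure (continuous_const_smul (b - a)) havg fun y hy => ?_
    exact hsmul _ (sub_nonneg.2 hab.le) y hy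
  rw [smul_smul, mul_inv_cancel₀ (sub_pos.2 hab).ne', one_smul] at h2
  have h3 : (fun i : F => ∫ m in Set.Ioc a b, w m * Real.exp (-m * |(i : ℝ)|)) =
      ∫ m in Set.Ioc a b, f m := by
    ext i
    exact (eval_integral (f := f) (fun i => hint i) i).symm
  rw [← h3] at h2
  exact h2

/-! ### Approximating the generalized Laplace kernel by mixtures. -/

open MeasureTheory in
theorem integrableOn_one_sub_exp_mul_rpow {p : ℝ} (hp : 0 < p) (hp1 : p < 1) :
    IntegrableOn (fun m : ℝ => (1 - Real.exp (-m)) * m ^ (-1 - p)) (Set.Ioi 0) := by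
  have hmeas : Measurable fun m : ℝ => (1 - Real.exp (-m)) * m ^ (-1 - p) := by fun_prop
  have hle : ∀ m : ℝ, 0 < m → ‖(1 - Real.exp (-m)) * m ^ (-1 - p)‖ =
      (1 - Real.exp (-m)) * m ^ (-1 - p) := fun m hm => by
    rw [Real.norm_of_nonneg]
    have : Real.exp (-m) ≤ 1 := Real.exp_le_one_iff.2 (by linarith)
    have := Real.rpow_nonneg hm.le (-1 - p)
    nlinarith
  rw [← Set.Ioc_union_Ioi_eq_Ioi zero_le_one]
  refine IntegrableOn.union ?_ ?_
  · have h1 : IntegrableOn (fun m : ℝ => m ^ (-p)) (Set.Ioc 0 1) :=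
      (intervalIntegrable_iff_integrableOn_Ioc_of_le zero_le_one).1
        (intervalIntegral.intervalIntegrable_rpow' (by linarith))
    refine Integrable.mono' h1 hmeas.aestronglyMeasurable ?_
    filter_upwards [ae_restrict_mem measurableSet_Ioc] with m hm
    rw [hle m hm.1]
    calc (1 - Real.exp (-m)) * m ^ (-1 - p) ≤ m * m ^ (-1 - p) := by
          refine mul_le_mul_of_nonneg_right ?_ (Real.rpow_nonneg hm.1.le _)
          linarith [Real.add_one_le_exp (-m)]
      _ = m ^ (-p) := by
          nth_rewrite 1 [← Real.rpow_one m]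
          rw [← Real.rpow_add hm.1]
          congr 1
          ring
  · refine Integrable.mono' (integrableOn_Ioi_rpow_of_lt (by linarith : -1 - p < -1) one_pos)
      hmeas.aestronglyMeasurable ?_
    filter_upwards [ae_restrict_mem measurableSet_Ioi] with m hm
    have hm0 : (0 : ℝ) < m := one_pos.trans hm
    rw [hle m hm0]
    have := Real.rpow_nonneg hm0.le (-1 - p)
    nlinarith [Real.exp_pos (-m)]

open MeasureTheory in
theorem integral_one_sub_exp_mul_rpow_pos {p : ℝ} (hp : 0 < p) (hp1 : p < 1) :
    0 < ∫ m in Set.Ioi (0 : ℝ), (1 - Real.exp (-m)) * m ^ (-1 - p) := by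
  have hpos : ∀ m ∈ Set.Ioi (0 : ℝ), 0 < (1 - Real.exp (-m)) * m ^ (-1 - p) := fun m hm =>
    mul_pos (sub_pos.2 (Real.exp_lt_one_iff.2 (neg_lt_zero.2 hm))) (Real.rpow_pos_of_pos hm _)
  rw [setIntegral_pos_iff_support_of_nonneg_ae _ (integrableOn_one_sub_exp_mul_rpow hp hp1)]
  · have : Function.support (fun m : ℝ => (1 - Real.exp (-m)) * m ^ (-1 - p)) ∩ Set.Ioi 0 =
        Set.Ioi 0 := Set.inter_eq_right.2 fun m hm => (hpos m hm).ne'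
    rw [this]
    simp
  · filter_upwards [ae_restrict_mem measurableSet_Ioi] with m hm
    exact (hpos m hm).le

open MeasureTheory in
/-- The Lévy–Khintchine representation of the Bernstein function `x ↦ x ^ p`. -/
theorem integrableOn_and_integral_one_sub_exp_mul_rpow {p : ℝ} (hp : 0 < p) (hp1 : p < 1) {x : ℝ}
    (hx : 0 ≤ x) :
    IntegrableOn (fun m : ℝ => (1 - Real.exp (-m * x)) * m ^ (-1 - p)) (Set.Ioi 0) ∧
    ∫ m in Set.Ioi (0 : ℝ), (1 - Real.exp (-m * x)) * m ^ (-1 - p) =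
      x ^ p * ∫ m in Set.Ioi (0 : ℝ), (1 - Real.exp (-m)) * m ^ (-1 - p) := by
  rcases hx.eq_or_lt with rfl | hx
  · simp [Real.zero_rpow hp.ne']
  have hi := integrableOn_one_sub_exp_mul_rpow hp hp1
  have heq : ∀ m ∈ Set.Ioi (0 : ℝ), (1 - Real.exp (-m * x)) * m ^ (-1 - p) =
      x ^ (1 + p) * ((1 - Real.exp (-(x * m))) * (x * m) ^ (-1 - p)) := fun m hm => by
    rw [Real.mul_rpow hx.le (le_of_lt hm)]
    have : x ^ (1 + p) * x ^ (-1 - p) = 1 := by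
      rw [← Real.rpow_add hx]; simp
    rw [show -m * x = -(x * m) by ring]
    linear_combination (-(1 - Real.exp (-(x * m))) * m ^ (-1 - p)) * this
  constructor
  · rw [integrableOn_congr_fun heq measurableSet_Ioi]
    refine Integrable.const_mul ?_ _
    have := (integrableOn_Ioi_comp_mul_left_iff
      (fun m : ℝ => (1 - Real.exp (-m)) * m ^ (-1 - p)) 0 hx).2 (by rwa [mul_zero])
    exact this
  · rw [setIntegral_congr_fun measurableSet_Ioi heq, integral_const_mul,
      integral_comp_mul_left_Ioi (fun m : ℝ => (1 - Real.exp (-m)) * m ^ (-1 - p)) 0 hx, mul_zero,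
      smul_eq_mul, ← mul_assoc]
    congr 1
    rw [Real.rpow_add hx, Real.rpow_one]
    field_simp

open MeasureTheory in
theorem exp_neg_mul_abs_rpow_mem_topologicalClosure {lam p : ℝ} (hl : 0 < lam) (hp : 0 < p)
    (hp1 : p ≤ 1) :
    (fun x : ℝ => Real.exp (-lam * |x| ^ p)) ∈ expConeAlgebra.topologicalClosure := by
  rcases hp1.eq_or_lt with rfl | hp1
  · simp only [Real.rpow_one]
    exact Subalgebra.le_topologicalClosure _ (exp_neg_mul_abs_mem_expConeAlgebra hl.le)
  set I := ∫ m in Set.Ioi (0 : ℝ), (1 - Real.exp (-m)) * m ^ (-1 - p) with hI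
  have hIpos : 0 < I := integral_one_sub_exp_mul_rpow_pos hp hp1
  -- Truncation away from `0` makes `m ^ (-1 - p)` integrable, so `1` and `exp (-m|x|)` can be
  -- integrated separately. The shift by `2` keeps the interval nonempty at `n = 0`.
  let s : ℕ → Set ℝ := fun n => Set.Ioc (1 / ((n : ℝ) + 2)) ((n : ℝ) + 2)
  have hlt : ∀ n : ℕ, 1 / ((n : ℝ) + 2) < (n : ℝ) + 2 := fun n => by
    rw [div_lt_iff₀ (by positivity)]
    nlinarith [(n.cast_nonneg : (0 : ℝ) ≤ n)]
  have hpos : ∀ n : ℕ, 0 < 1 / ((n : ℝ) + 2) := fun n => by positivity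
  have hmono : Monotone s := fun n k hnk => by
    have : (n : ℝ) ≤ k := by exact_mod_cast hnk
    exact Set.Ioc_subset_Ioc (by gcongr) (by gcongr)
  have hUnion : ⋃ n, s n = Set.Ioi (0 : ℝ) := by
    ext m
    simp only [Set.mem_iUnion, Set.mem_Ioi]
    constructor
    · rintro ⟨n, hn⟩
      exact (hpos n).trans hn.1
    · intro hm
      obtain ⟨n, hn⟩ := exists_nat_gt (max m (1 / m))
      refine ⟨n, ?_, ?_⟩
      · rw [div_lt_comm₀ (by positivity) hm]
        linarith [le_max_right m (1 / m)]
      · linarith [le_max_left m (1 / m)]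
  have hint : ∀ n x, IntegrableOn (fun m : ℝ => m ^ (-1 - p) * Real.exp (-m * |x|)) (s n) :=
    fun n x => by
      refine (ContinuousOn.integrableOn_Icc ?_).mono_set Set.Ioc_subset_Icc_self
      refine ContinuousOn.mul ?_ (by fun_prop)
      exact continuousOn_id.rpow_const fun m hm => Or.inl ((hpos n).trans_le hm.1).ne'
  have hlim : Tendsto (fun (n : ℕ) (x : ℝ) =>
      Real.exp (-(lam / I) * ∫ m in s n, (1 - Real.exp (-m * |x|)) * m ^ (-1 - p))) atTop
      (𝓝 fun x : ℝ => Real.exp (-lam * |x| ^ p)) := by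
    rw [tendsto_pi_nhds]
    intro x
    obtain ⟨h1, h2⟩ := integrableOn_and_integral_one_sub_exp_mul_rpow hp hp1 (abs_nonneg x)
    have h3 := tendsto_setIntegral_of_monotone (s := s) (fun _ => measurableSet_Ioc) hmono
      (by rwa [hUnion])
    rw [hUnion, h2, ← hI] at h3
    have h4 := (Real.continuous_exp.tendsto _).comp (h3.const_mul (-(lam / I)))
    have h5 : -(lam / I) * (|x| ^ p * I) = -lam * |x| ^ p := by field_simp
    rw [h5] at h4
    exact h4
  refine (Subalgebra.isClosed_topologicalClosure _).mem_of_tendsto hlim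
    (Eventually.of_forall fun n => ?_)
  have hv := exp_mem_topologicalClosure (Subalgebra.smul_mem _
    (integral_exp_mem_topologicalClosure (hpos n).le (hlt n)
      (fun m hm => Real.rpow_nonneg ((hpos n).trans hm.1).le (-1 - p)) (hint n))
    (⟨lam / I, by positivity⟩ : NNReal))
  -- The negative part of the exponent does not depend on `x`, so it is only a positive scalar
  -- factor.
  have hv' := Subalgebra.smul_mem _ hv
    (⟨Real.exp (-(lam / I) * ∫ m in s n, m ^ (-1 - p)), (Real.exp_pos _).le⟩ : NNReal)
  refine SetLike.mem_coe.2 ?_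
  convert hv' using 1
  ext x
  change _ = Real.exp (-(lam / I) * ∫ m in s n, m ^ (-1 - p)) *
    Real.exp (lam / I * ∫ m in s n, m ^ (-1 - p) * Real.exp (-m * |x|))
  rw [← Real.exp_add]
  congr 1
  have h0 := hint n 0
  simp only [abs_zero, mul_zero, Real.exp_zero, mul_one] at h0
  have hsub : ∫ m in s n, (1 - Real.exp (-m * |x|)) * m ^ (-1 - p) =
      (∫ m in s n, m ^ (-1 - p)) - ∫ m in s n, m ^ (-1 - p) * Real.exp (-m * |x|) := by
    rw [← integral_sub h0 (hint n x)]
    exact integral_congr_ae (Eventually.of_forall fun m => by ring)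
  rw [hsub]
  ring

theorem posMaxPrinciple_exp_neg_mul_abs_rpow {lam p : ℝ} (hl : 0 < lam) (hp : 0 < p)
    (hp1 : p ≤ 1) : PosMaxPrinciple fun x : ℝ => Real.exp (-lam * |x| ^ p) :=
  posMaxPrinciple_of_mem_topologicalClosure
    (exp_neg_mul_abs_rpow_mem_topologicalClosure hl hp hp1)

/-! ### Equilibrium potentials and strictness. -/

/-- If `c s₀ < 0`, dropping `s₀` leaves a potential equal to `y - c s₀ * φ (s' - s₀)` on `S`. Its
value at `s₀` is positive and exceeds all values on `S.erase s₀`, against the principle. -/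
theorem PosMaxPrinciple.nonneg_of_sum_eq {φ : ℝ → ℝ} (hφ : PosMaxPrinciple φ) (h0 : φ 0 = 1)
    (h1 : ∀ x, x ≠ 0 → φ x < 1) {S : Finset ℝ} {c : ℝ → ℝ} {y : ℝ} (hy : 0 ≤ y)
    (hc : ∀ s' ∈ S, ∑ s ∈ S, c s * φ (s' - s) = y) : ∀ s ∈ S, 0 ≤ c s := by
  intro s₀ hs₀
  by_contra! hneg
  have hsum : ∀ s' ∈ S, ∑ s ∈ S.erase s₀, c s * φ (s' - s) = y - c s₀ * φ (s' - s₀) :=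
    fun s' hs' => by rw [← hc s' hs', ← Finset.add_sum_erase S _ hs₀]; ring
  have h := hφ (S.erase s₀) c s₀
  rw [hsum s₀ hs₀, sub_self, h0] at h
  rcases h with h | ⟨s', hs', h⟩
  · linarith
  · rw [hsum s' (Finset.mem_of_mem_erase hs')] at h
    have := h1 (s' - s₀) (sub_ne_zero.2 (Finset.ne_of_mem_erase hs'))
    nlinarith

/-- Every finite set carries a nonnegative equilibrium distribution. -/
theorem PosMaxPrinciple.exists_equilibrium {φ : ℝ → ℝ} (hφ : PosMaxPrinciple φ) (h0 : φ 0 = 1)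
    (h1 : ∀ x, x ≠ 0 → φ x < 1) (S : Finset ℝ) :
    ∃ b : ℝ → ℝ, (∀ s ∈ S, 0 ≤ b s) ∧ ∀ s' ∈ S, ∑ s ∈ S, b s * φ (s' - s) = 1 := by
  classical
  let ext : (S → ℝ) → ℝ → ℝ := fun v x => if h : x ∈ S then v ⟨x, h⟩ else 0
  have hext : ∀ v (s : S), ext v s = v s := fun v s => by simp [ext]
  let K : (S → ℝ) →ₗ[ℝ] (S → ℝ) := Matrix.mulVecLin (Matrix.of fun s' s : S => φ (s' - s))
  have hK : ∀ v (s' : S), K v s' = ∑ s ∈ S, ext v s * φ (s' - s) := fun v s' => by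
    rw [← Finset.sum_coe_sort]
    simp only [K, Matrix.mulVecLin_apply, Matrix.mulVec, dotProduct, Matrix.of_apply, hext]
    exact Finset.sum_congr rfl fun s _ => mul_comm _ _
  have hnn : ∀ v, K v = 0 → ∀ s, 0 ≤ v s := fun v hv s => by
    refine (hext v s).subst (motive := fun r => 0 ≤ r) ?_
    refine hφ.nonneg_of_sum_eq h0 h1 le_rfl (fun s' hs' => ?_) s s.2
    rw [← hK v ⟨s', hs'⟩, hv, Pi.zero_apply]
  -- A kernel vector and its negative are both nonnegative.
  have hinj : Function.Injective K := by
    rw [← LinearMap.ker_eq_bot, LinearMap.ker_eq_bot']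
    intro v hv
    ext s
    have h2 := hnn (-v) (by rw [map_neg, hv, neg_zero]) s
    exact le_antisymm (by simpa using h2) (hnn v hv s)
  obtain ⟨v, hv⟩ := LinearMap.injective_iff_surjective.1 hinj 1
  have heq : ∀ s' ∈ S, ∑ s ∈ S, ext v s * φ (s' - s) = 1 := fun s' hs' => by
    rw [← hK v ⟨s', hs'⟩, hv, Pi.one_apply]
  exact ⟨ext v, hφ.nonneg_of_sum_eq h0 h1 zero_le_one heq, heq⟩

/-- A value `1` off `S` would be a maximum, but there the potential is strictly midpoint convex at
small scale, since some weight is positive. -/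
theorem PosMaxPrinciple.equilibrium_lt_one {φ : ℝ → ℝ} (hφ : PosMaxPrinciple φ)
    (hconv : ∀ x h, 0 < h → h < |x| → 2 * φ x < φ (x + h) + φ (x - h))
    {S : Finset ℝ} {b : ℝ → ℝ} (hb : ∀ s ∈ S, 0 ≤ b s)
    (hQ : ∀ s' ∈ S, ∑ s ∈ S, b s * φ (s' - s) = 1) {t : ℝ} (ht : t ∉ S) :
    ∑ s ∈ S, b s * φ (t - s) < 1 := by
  have hle : ∀ x, ∑ s ∈ S, b s * φ (x - s) ≤ 1 := fun x => by
    rcases hφ S b x with h | ⟨s', hs', h⟩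
    · exact h.trans zero_le_one
    · exact h.trans (hQ s' hs').le
  refine lt_of_le_of_ne (hle t) fun heq => ?_
  have hev : ∀ᶠ h : ℝ in 𝓝[>] 0, ∀ s ∈ S, h < |t - s| :=
    (Finset.eventually_all S).2 fun s hs => nhdsWithin_le_nhds
      (eventually_lt_nhds (abs_pos.2 (sub_ne_zero.2 fun h => ht (h ▸ hs))))
  obtain ⟨h, hh, hpos⟩ := (hev.and self_mem_nhdsWithin).exists
  have hpos' : (0 : ℝ) < h := hpos
  obtain ⟨s₀, hs₀, hne⟩ : ∃ s ∈ S, b s * φ (t - s) ≠ 0 :=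
    Finset.exists_ne_zero_of_sum_ne_zero (by rw [heq]; exact one_ne_zero)
  have hb₀ : 0 < b s₀ := (hb s₀ hs₀).lt_of_ne' (left_ne_zero_of_mul hne)
  have hlt : ∑ s ∈ S, b s * (2 * φ (t - s)) <
      ∑ s ∈ S, b s * (φ (t - s + h) + φ (t - s - h)) :=
    Finset.sum_lt_sum
      (fun s hs => mul_le_mul_of_nonneg_left (hconv _ _ hpos' (hh s hs)).le (hb s hs))
      ⟨s₀, hs₀, mul_lt_mul_of_pos_left (hconv _ _ hpos' (hh s₀ hs₀)) hb₀⟩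
  have e1 : ∑ s ∈ S, b s * (2 * φ (t - s)) = 2 := by
    calc _ = 2 * ∑ s ∈ S, b s * φ (t - s) := by
          rw [Finset.mul_sum]
          exact Finset.sum_congr rfl fun s _ => by ring
      _ = 2 := by rw [heq, mul_one]
  have e2 : ∑ s ∈ S, b s * (φ (t - s + h) + φ (t - s - h)) =
      ∑ s ∈ S, b s * φ (t + h - s) + ∑ s ∈ S, b s * φ (t - h - s) := by
    rw [← Finset.sum_add_distrib]
    refine Finset.sum_congr rfl fun s _ => ?_
    rw [show t - s + h = t + h - s by ring, show t - s - h = t - h - s by ring, mul_add]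
  rw [e1, e2] at hlt
  linarith [hle (t + h), hle (t - h)]

/-- The potential of `c - M * b` is nonpositive on `S`, hence everywhere, so that of `c` is at most
`M` times the equilibrium potential. -/
theorem PosMaxPrinciple.sum_lt_of_notMem {φ : ℝ → ℝ} (hφ : PosMaxPrinciple φ) (h0 : φ 0 = 1)
    (h1 : ∀ x, x ≠ 0 → φ x < 1)
    (hconv : ∀ x h, 0 < h → h < |x| → 2 * φ x < φ (x + h) + φ (x - h))
    {S : Finset ℝ} {c : ℝ → ℝ} {M t : ℝ} (hM : 0 < M)
    (hc : ∀ s' ∈ S, ∑ s ∈ S, c s * φ (s' - s) ≤ M) (ht : t ∉ S) :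
    ∑ s ∈ S, c s * φ (t - s) < M := by
  obtain ⟨b, hb, hQ⟩ := hφ.exists_equilibrium h0 h1 S
  have hlt := hφ.equilibrium_lt_one hconv hb hQ ht
  have hsub : ∀ x, ∑ s ∈ S, (c s - M * b s) * φ (x - s) =
      ∑ s ∈ S, c s * φ (x - s) - M * ∑ s ∈ S, b s * φ (x - s) := fun x => by
    rw [Finset.mul_sum, ← Finset.sum_sub_distrib]
    exact Finset.sum_congr rfl fun s _ => by ring
  have hle : ∑ s ∈ S, (c s - M * b s) * φ (t - s) ≤ 0 := by
    rcases hφ S (fun s => c s - M * b s) t with h | ⟨s', hs', h⟩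
    · exact h
    · refine h.trans ?_
      rw [hsub, hQ s' hs']
      linarith [hc s' hs']
  rw [hsub] at hle
  nlinarith

/-! ### The generalized Laplace kernel on one axis and on grids. -/

theorem two_mul_exp_neg_mul_abs_rpow_lt {lam p : ℝ} (hl : 0 < lam) (hp : 0 < p) (hp1 : p ≤ 1)
    (x h : ℝ) (hh : 0 < h) (hx : h < |x|) :
    2 * Real.exp (-lam * |x| ^ p) <
      Real.exp (-lam * |x + h| ^ p) + Real.exp (-lam * |x - h| ^ p) := by
  -- reduction to `x > 0`
  wlog hpos : 0 < x generalizing x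
  · have hx0 : x ≠ 0 := fun h0 => by rw [h0, abs_zero] at hx; linarith
    have := this (-x) (by rwa [abs_neg]) (by
      have := lt_of_le_of_ne (not_lt.1 hpos) hx0
      linarith)
    rw [abs_neg, show -x + h = -(x - h) by ring, show -x - h = -(x + h) by ring, abs_neg,
      abs_neg] at this
    linarith
  rw [abs_of_pos hpos] at hx
  rw [abs_of_pos hpos, abs_of_pos (by linarith : 0 < x + h), abs_of_pos (by linarith : 0 < x - h)]
  have hhalf : (0 : ℝ) < 1 / 2 := by norm_num
  have hconc := (Real.concaveOn_rpow hp.le hp1).2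
    (show x + h ∈ Set.Ici 0 from Set.mem_Ici.2 (by linarith))
    (show x - h ∈ Set.Ici 0 from Set.mem_Ici.2 (by linarith)) hhalf.le hhalf.le (by norm_num)
  simp only [smul_eq_mul] at hconc
  rw [show 1 / 2 * (x + h) + 1 / 2 * (x - h) = x by ring] at hconc
  have hne : (x - h) ^ p < (x + h) ^ p := Real.rpow_lt_rpow (by linarith) (by linarith) hp
  have hexp := strictConvexOn_exp.2 (Set.mem_univ (-lam * (x + h) ^ p))
    (Set.mem_univ (-lam * (x - h) ^ p)) (by nlinarith) hhalf hhalf (by norm_num)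
  simp only [smul_eq_mul] at hexp
  have hmono : Real.exp (-lam * x ^ p) ≤
      Real.exp (1 / 2 * (-lam * (x + h) ^ p) + 1 / 2 * (-lam * (x - h) ^ p)) :=
    Real.exp_le_exp.2 (by nlinarith)
  linarith

theorem exp_neg_mul_abs_rpow_sum_lt {lam p : ℝ} (hl : 0 < lam) (hp : 0 < p) (hp1 : p ≤ 1)
    {S : Finset ℝ} {c : ℝ → ℝ} {M t : ℝ} (hM : 0 < M)
    (hc : ∀ s' ∈ S, ∑ s ∈ S, c s * Real.exp (-lam * |s' - s| ^ p) ≤ M) (ht : t ∉ S) :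
    ∑ s ∈ S, c s * Real.exp (-lam * |t - s| ^ p) < M :=
  (posMaxPrinciple_exp_neg_mul_abs_rpow hl hp hp1).sum_lt_of_notMem
    (by simp [Real.zero_rpow hp.ne'])
    (fun x hx => Real.exp_lt_one_iff.2 (by
      have := Real.rpow_pos_of_pos (abs_pos.2 hx) p
      nlinarith))
    (two_mul_exp_neg_mul_abs_rpow_lt hl hp hp1) hM hc ht

theorem argmaxSet_nonempty_and_subset {lam p : ℝ} (hl : 0 < lam) (hp : 0 < p) (hp1 : p ≤ 1)
    (S : Finset ℝ) (c : ℝ → ℝ)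
    (hne : ∃ t, |∑ s ∈ S, c s * Real.exp (-lam * |t - s| ^ p)| ≠ 0) :
    (argmaxSet fun t => |∑ s ∈ S, c s * Real.exp (-lam * |t - s| ^ p)|).Nonempty ∧
      argmaxSet (fun t => |∑ s ∈ S, c s * Real.exp (-lam * |t - s| ^ p)|) ⊆ (S : Set ℝ) := by
  obtain ⟨t₁, ht₁⟩ := hne
  have hpos : 0 < |∑ s ∈ S, c s * Real.exp (-lam * |t₁ - s| ^ p)| :=
    (abs_nonneg _).lt_of_ne' ht₁
  constructor
  · have hcont : Continuous fun t => |∑ s ∈ S, c s * Real.exp (-lam * |t - s| ^ p)| := by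
      refine (continuous_finsetSum _ fun s _ => continuous_const.mul ?_).abs
      refine Real.continuous_exp.comp (continuous_const.mul ?_)
      exact (continuous_id.sub continuous_const).abs.rpow_const fun _ => Or.inr hp.le
    have hvan : Tendsto (fun t => |∑ s ∈ S, c s * Real.exp (-lam * |t - s| ^ p)|) (cocompact ℝ)
        (𝓝 0) := by
      have h : Tendsto (fun t => |∑ s ∈ S, c s * Real.exp (-lam * |t - s| ^ p)|) (cocompact ℝ)
          (𝓝 |∑ s ∈ S, c s * 0|) := by
        refine (tendsto_finsetSum _ fun s _ => Tendsto.const_mul _ ?_).abs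
        have h1 : Tendsto (fun t : ℝ => |t - s|) (cocompact ℝ) atTop :=
          tendsto_norm_cocompact_atTop.comp
            (Homeomorph.addRight (-s)).isClosedEmbedding.tendsto_cocompact
        exact Real.tendsto_exp_atBot.comp
          (((tendsto_rpow_atTop hp).comp h1).const_mul_atTop_of_neg (neg_lt_zero.2 hl))
      simpa using h
    obtain ⟨t₀, -, h⟩ := exists_pos_forall_le_of_tendsto_cocompact hcont hvan hpos
    exact ⟨t₀, h⟩
  · intro t ht
    by_contra hS
    have hM := hpos.trans_le (ht t₁)
    -- The strict bound is applied to `c` and to `-c`, with `M` the value of the section at the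
    -- maximizer `t`.
    have hneg : ∀ x, ∑ s ∈ S, -c s * Real.exp (-lam * |x - s| ^ p) =
        -∑ s ∈ S, c s * Real.exp (-lam * |x - s| ^ p) := fun x => by
      rw [← Finset.sum_neg_distrib]
      exact Finset.sum_congr rfl fun s _ => by ring
    have hlt := exp_neg_mul_abs_rpow_sum_lt hl hp hp1 hM
      (fun s' _ => (le_abs_self _).trans (ht s')) (mt Finset.mem_coe.2 hS)
    have hlt' := exp_neg_mul_abs_rpow_sum_lt (c := fun s => -c s) hl hp hp1 hM
      (fun s' _ => by rw [hneg]; exact (neg_le_abs _).trans (ht s')) (mt Finset.mem_coe.2 hS)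
    rw [hneg] at hlt'
    exact (abs_lt.2 ⟨by linarith, hlt⟩).ne rfl

theorem mainTheorem6 {D : ℕ} (hD : 1 ≤ D)
    {H : Type*} [NormedAddCommGroup H] [InnerProductSpace ℝ H] [CompleteSpace H]
    (a : (Fin D → ℝ) → H) (ha : IsGeneralizedLaplaceDictionary a)
    (G : Finset (Fin D → ℝ)) (hG : IsCartesianGrid G) :
    IsAxisAdmissibleForDictionary a G := by
  obtain ⟨lam, p, hl, hp, hp1, hκ⟩ := ha
  refine ⟨hG, ?_⟩
  rintro S rfl d θ hθ c hne
  -- Grid points sharing the coordinate `s` along `d` are grouped; their factors in the other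
  -- coordinates do not depend on `t` and go into the coefficient of `s`.
  have hsec : axisSection (inducedKernel a) (Fintype.piFinset S) c d θ = fun t =>
      |∑ s ∈ S d, (∑ η ∈ Fintype.piFinset S with η d = s,
        c η * Real.exp (-lam * ∑ i ∈ Finset.univ.erase d, |θ i - η i| ^ p)) *
          Real.exp (-lam * |t - s| ^ p)| := by
    ext t
    unfold axisSection
    congr 1
    rw [← Finset.sum_fiberwise_of_maps_to (g := fun η => η d) (t := S d)
      (fun η hη => Fintype.mem_piFinset.1 hη d)]
    refine Finset.sum_congr rfl fun s _ => ?_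
    rw [Finset.sum_mul]
    refine Finset.sum_congr rfl fun η hη => ?_
    have hηd : η d = s := (Finset.mem_filter.1 hη).2
    rw [hκ, norm_toLp_ofReal_rpow hp, ← Finset.add_sum_erase _ _ (Finset.mem_univ d), mul_assoc,
      ← Real.exp_add]
    congr 2
    have h1 : ∑ i ∈ Finset.univ.erase d, |(θ + t • Pi.single d 1 - η : Fin D → ℝ) i| ^ p =
        ∑ i ∈ Finset.univ.erase d, |θ i - η i| ^ p :=
      Finset.sum_congr rfl fun i hi => by
        simp [Pi.single_eq_of_ne (Finset.ne_of_mem_erase hi)]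
    rw [h1]
    simp [hθ, hηd]
    ring
  rw [hsec] at hne ⊢
  exact argmaxSet_nonempty_and_subset hl hp hp1 (S d) _ hne
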